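/- A single item is sold to $n$ bidders with values in $[0,\infty)$. A mechanism maps a reported value profile $v$ to winning probabilities $x_i(v)\ge 0$, $\sum_i x_i(v)\le 1$, and payments $p_i(v)$ (both measurable); it is DSIC if truthful reporting maximizes the utility $v_ix_i-p_i$ of each bidder whatever the others report, and IR if truthful utilities are nonnegative. For a distribution $\mathbf D$ of value profiles, $\mathrm{Rev}(M,\mathbf D)=\mathbb E_{v\sim\mathbf D}[\sum_i p_i(v)]$, and $\mathrm{Opt}(\mathbf D)$ is the supremum of $\mathrm{Rev}(M,\mathbf D)$ over the DSIC and IR mechanisms $M$ with $\sum_i p_i$ integrable under $\mathbf D$; such an $M$ is optimal for $\mathbf D$ if its revenue is the largest among them. **Theorem.** There is an absolute constant $C>0$ such that for all $n\ge 0$, $h>0$, $\varepsilon>0$ and $m\ge 1$ there is a learning algorithm $A$, assigning to every sequence $s=(s^{(1)},\dots,s^{(m)})$ of $m$ value profiles a DSIC and IR mechanism $A(s)$, with the following properties. 1. $A(s)$ depends on the samples, and its allocation and payments depend on the reported values, only through the values rounded down to multiples of $\varepsilon$. 2. If all samples lie in $[0,h]^n$, then $A(s)$ is an optimal auction for the product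 $E^1\times\dots\times E^n$ of the empirical distributions, where $E^i$ is the uniform distribution over the rounded-down values of bidder $i$ in the $m$ samples. 3. For every product distribution $\mathbf D=D^1\times\dots\times D^n$ with each $D^i$ a probability distribution supported in $[0,h]$, and $s^{(1)},\dots,s^{(m)}$ drawn i.i.d. from $\mathbf D$: the payments of $A(s)$ are integrable under $\mathbf D$ for all samples in $[0,h]^n$, the revenue $\mathrm{Rev}(A(s),\mathbf D)$ is integrable over the samples, and - if $m\ge C\,n\,(h/\varepsilon)^3\log(2+nh/\varepsilon)$, that is, with $\tilde O(h^3n\varepsilon^{-3})$ samples, then $$\mathbb E_{s}\big[\mathrm{Rev}(A(s),\mathbf D)\big]\ \ge\ \mathrm{Opt}(\mathbf D)-C\varepsilon;$$ - for every $\gamma\in(0,1)$, if $m\ge C\,(h/\varepsilon)^2\big(n(h/\varepsilon)\log(2+nh/\varepsilon)+\log(1/\gamma)\big)$, then with probability at least $1-\gamma$ over the samples $$\mathrm{Rev}(A(s),\mathbf D)\ \ge\ \mathrm{Opt}(\mathbf D)-C\varepsilon.$$ -/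

import Mathlib

open MeasureTheory
open scoped NNReal ENNReal

noncomputable section

/-- A direct revelation mechanism for selling one item to `n` bidders with values in `[0, ∞)`:
on a reported value profile `v`, bidder `i` wins with probability `alloc v i` and pays `pay v i`. -/
structure Mechanism (n : ℕ) where
  alloc : (Fin n → ℝ≥0) → Fin n → ℝ
  pay : (Fin n → ℝ≥0) → Fin n → ℝ
  alloc_nonneg : ∀ v i, 0 ≤ alloc v i
  alloc_sum_le_one : ∀ v, ∑ i, alloc v i ≤ 1
  measurable_alloc : Measurable alloc
  measurable_pay : Measurable pay

namespace Mechanism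

variable {n : ℕ}

/-- Utility of bidder `i` with true value `t` when the reported profile is `v`. -/
def utility (M : Mechanism n) (i : Fin n) (t : ℝ≥0) (v : Fin n → ℝ≥0) : ℝ :=
  (t : ℝ) * M.alloc v i - M.pay v i

/-- Dominant strategy incentive compatibility: whatever the others report, no bidder `i`
gains by reporting some `w` instead of the true value `v i`. -/
def IsDSIC (M : Mechanism n) : Prop :=
  ∀ (v : Fin n → ℝ≥0) (i : Fin n) (w : ℝ≥0),
    M.utility i (v i) (Function.update v i w) ≤ M.utility i (v i) v

/-- Individual rationality: truthful utilities are nonnegative at every value profile. -/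
def IsIR (M : Mechanism n) : Prop :=
  ∀ (v : Fin n → ℝ≥0) (i : Fin n), 0 ≤ M.utility i (v i) v

/-- Expected revenue when the value profile is drawn from `D`. -/
def rev (M : Mechanism n) (D : Measure (Fin n → ℝ≥0)) : ℝ :=
  ∫ v, ∑ i, M.pay v i ∂D

/-- DSIC and IR mechanisms whose expected revenue on `D` is a well-defined real number. -/
def IsAdmissible (M : Mechanism n) (D : Measure (Fin n → ℝ≥0)) : Prop :=
  M.IsDSIC ∧ M.IsIR ∧ Integrable (fun v => ∑ i, M.pay v i) D

/-- `M` is an optimal auction for `D`. -/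
def IsOptimal (M : Mechanism n) (D : Measure (Fin n → ℝ≥0)) : Prop :=
  M.IsAdmissible D ∧ ∀ M' : Mechanism n, M'.IsAdmissible D → M'.rev D ≤ M.rev D

end Mechanism

/-- The optimal revenue: the supremum of the expected revenues of DSIC and IR mechanisms. -/
def optRev {n : ℕ} (D : Measure (Fin n → ℝ≥0)) : ℝ :=
  sSup {r : ℝ | ∃ M : Mechanism n, M.IsAdmissible D ∧ M.rev D = r}

/-- The largest multiple of `ε` that is at most `v` (for `0 < ε`). -/
def roundDown (ε v : ℝ≥0) : ℝ≥0 := (⌊v / ε⌋₊ : ℝ≥0) * ε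

/-- The empirical distribution of bidder `i`: the uniform distribution over the `i`-th values
`s 0 i, …, s (m - 1) i` (with multiplicity) of the `m` sampled profiles. -/
def empirical {m n : ℕ} (s : Fin m → Fin n → ℝ≥0) (i : Fin n) : Measure ℝ≥0 :=
  (m : ℝ≥0∞)⁻¹ • ∑ j, Measure.dirac (s j i)

/-- The empirical product distribution. -/
def empiricalProduct {m n : ℕ} (s : Fin m → Fin n → ℝ≥0) : Measure (Fin n → ℝ≥0) :=
  Measure.pi (empirical s)

/-- The law of `m` independent value profiles drawn from the product of the `D i`. -/
def sampleLaw (m : ℕ) {n : ℕ} (D : Fin n → Measure ℝ≥0) : Measure (Fin m → Fin n → ℝ≥0) :=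
  Measure.pi fun _ : Fin m => Measure.pi D

end

/-!
The learner rounds the samples down to multiples of `ε` and picks, among all monotone allocation
rules on grid levels, one of maximal revenue under threshold payments for the product of the
empirical laws of the levels. A maximizer exists because these rules form a compact set and the
revenue is continuous (`exists_gridRev_max`); no description of it by virtual values is needed.
Threshold payments are the largest incentive compatible ones, so the learned mechanism is optimal
among all DSIC and IR mechanisms on the rounded empirical product (`exists_gridRev_ge` at `c = 0`).

For the true law, a DSIC and IR mechanism is compared with the grid mechanism that replaces each
level by a representative of its cell. Choosing the representatives at random from the conditional
laws, independently over bidders and levels, reproduces the original revenue on average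
(`exists_representatives`), and passing to threshold payments costs at most `ε`
(`exists_gridRev_ge` at `c = 1`).

What remains is to bound the total variation distance between the products `E` and `D` of the
empirical and the true laws of the levels. The likelihood ratio `∏ E / ∏ D` of the sample exceeds
`Θ` with probability at most `(m + 1) ^ (n * (K + 1)) / Θ`, as there are at most
`(m + 1) ^ (n * (K + 1))` tuples of empirical laws on `K + 1` levels (`sum_bad_le`). Off this event
the inequality of arithmetic and geometric means bounds the Hellinger affinity of `E` and `D` from
below by `Θ ^ (-1 / (2 * m))`, whence their distance is at most `2 * √(log Θ / m)`
(`sum_abs_prod_sub_le`). Revenues lie in `[0, h]`, so optimality on `E` transfers to `D` up to `2 * h`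
times that distance (`optRev_le_rev_learner`). With `Θ = (m + 1) ^ (n * (K + 1)) / γ` this is the
bound with probability `1 - γ`; the one in expectation follows by taking `γ = 1 / (2 + n * h / ε)`.
-/

/-! ### Empirical laws on a finite alphabet -/

lemma sum_pi_prod_eq_one {n : ℕ} {α : Type*} [Fintype α] {p : Fin n → α → ℝ}
    (hp : ∀ i, ∑ a, p i a = 1) :
    ∑ k : Fin n → α, ∏ i, p i (k i) = 1 := by
  rw [← Fintype.piFinset_univ, ← Finset.prod_univ_sum]
  simp [hp]

lemma sum_pi_pi_prod_eq_one {m n : ℕ} {α : Type*} [Fintype α] {p : Fin n → α → ℝ}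
    (hp : ∀ i, ∑ a, p i a = 1) :
    ∑ t : Fin m → Fin n → α, ∏ j, ∏ i, p i (t j i) = 1 :=
  sum_pi_prod_eq_one (p := fun (_ : Fin m) (u : Fin n → α) => ∏ i, p i (u i))
    fun _ => sum_pi_prod_eq_one (p := p) hp

/-- Total variation is controlled by the Hellinger affinity. -/
lemma sum_abs_sub_le_affinity {α : Type*} [Fintype α] {e p : α → ℝ}
    (he : ∀ a, 0 ≤ e a) (hp : ∀ a, 0 ≤ p a)
    (he1 : ∑ a, e a = 1) (hp1 : ∑ a, p a = 1) :
    ∑ a, |e a - p a| ≤ 2 * √(1 - (∑ a, √(e a) * √(p a)) ^ 2) := by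
  set B := ∑ a, √(e a) * √(p a) with hB
  have h1 : ∑ a, |√(e a) - √(p a)| ^ 2 = 2 - 2 * B := by
    rw [hB, Finset.mul_sum]
    have : ∀ a, |√(e a) - √(p a)| ^ 2 = e a + p a - 2 * (√(e a) * √(p a)) := fun a => by
      rw [sq_abs, sub_sq, Real.sq_sqrt (he a), Real.sq_sqrt (hp a)]; ring
    simp only [this, Finset.sum_sub_distrib, Finset.sum_add_distrib, he1, hp1]
    norm_num
  have h2 : ∑ a, (√(e a) + √(p a)) ^ 2 = 2 + 2 * B := by
    rw [hB, Finset.mul_sum]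
    have : ∀ a, (√(e a) + √(p a)) ^ 2 = e a + p a + 2 * (√(e a) * √(p a)) := fun a => by
      rw [add_sq, Real.sq_sqrt (he a), Real.sq_sqrt (hp a)]; ring
    simp only [this, Finset.sum_add_distrib, he1, hp1]
    norm_num
  have h3 : ∀ a, |e a - p a| = |√(e a) - √(p a)| * (√(e a) + √(p a)) := fun a => by
    rw [← abs_of_nonneg (add_nonneg (Real.sqrt_nonneg (e a)) (Real.sqrt_nonneg (p a))), ← abs_mul]
    congr 1
    nlinarith [Real.sq_sqrt (he a), Real.sq_sqrt (hp a)]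
  have h4 : (∑ a, |e a - p a|) ^ 2 ≤ (2 - 2 * B) * (2 + 2 * B) := by
    simp only [h3]
    rw [← h1, ← h2]
    exact Finset.sum_mul_sq_le_sq_mul_sq _ _ _
  have h5 : 2 * √(1 - B ^ 2) = √((2 - 2 * B) * (2 + 2 * B)) := by
    rw [show (2 - 2 * B) * (2 + 2 * B) = 2 ^ 2 * (1 - B ^ 2) by ring,
      Real.sqrt_mul (by positivity), Real.sqrt_sq (by norm_num)]
  rw [h5]
  exact Real.le_sqrt_of_sq_le h4

/-- The relative frequency of the letter `a` among the `i`-th coordinates of `t 0, …, t (m - 1)`. -/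
noncomputable def freq {m n : ℕ} {α : Type*} [DecidableEq α] (t : Fin m → Fin n → α) (i : Fin n)
    (a : α) : ℝ :=
  ((Finset.univ.filter fun j => t j i = a).card : ℝ) / m

section Finite

variable {m n : ℕ} {α : Type*} [DecidableEq α]

lemma freq_nonneg (t : Fin m → Fin n → α) (i : Fin n) (a : α) : 0 ≤ freq t i a := by
  unfold freq; positivity

lemma freq_pos (t : Fin m → Fin n → α) (i : Fin n) (j : Fin m) : 0 < freq t i (t j i) := by
  have hm : 0 < m := j.pos
  have : 0 < (Finset.univ.filter fun j' => t j' i = t j i).card :=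
    Finset.card_pos.2 ⟨j, by simp⟩
  unfold freq; positivity

variable [Fintype α]

lemma sum_freq_mul (t : Fin m → Fin n → α) (i : Fin n) (f : α → ℝ) :
    ∑ a, freq t i a * f a = (∑ j, f (t j i)) / m := by
  have h : ∑ j, f (t j i) = ∑ a, ((Finset.univ.filter fun j => t j i = a).card : ℝ) * f a := by
    rw [← Finset.sum_fiberwise (s := Finset.univ) (g := fun j => t j i)]
    refine Finset.sum_congr rfl fun a _ => ?_
    rw [← nsmul_eq_mul, ← Finset.sum_const]
    refine Finset.sum_congr rfl fun j hj => ?_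
    rw [(Finset.mem_filter.1 hj).2]
  rw [h, Finset.sum_div]
  exact Finset.sum_congr rfl fun a _ => by unfold freq; ring

lemma sum_freq (hm : 0 < m) (t : Fin m → Fin n → α) (i : Fin n) : ∑ a, freq t i a = 1 := by
  have := sum_freq_mul t i fun _ => 1
  have hm' : (m : ℝ) ≠ 0 := by positivity
  simpa [hm'] using this

/-- The maximal likelihoods of all samples add up to at most the number of types: within one type
class the empirical law is fixed, and it gives the class mass at most one. -/
lemma sum_prod_freq_le (hm : 0 < m) :
    ∑ t : Fin m → Fin n → α, ∏ j, ∏ i, freq t i (t j i)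
      ≤ ((m : ℝ) + 1) ^ (n * Fintype.card α) := by
  classical
  let T : (Fin m → Fin n → α) → (Fin n → α → Fin (m + 1)) := fun t i a =>
    ⟨(Finset.univ.filter fun j => t j i = a).card,
      Nat.lt_succ_of_le ((Finset.card_le_univ _).trans (by simp))⟩
  have hT : ∀ t t', T t = T t' → freq t = freq t' := by
    intro t t' h
    funext i a
    have := congrArg Fin.val (congrFun (congrFun h i) a)
    simp only [T] at this
    simp only [freq, this]
  rw [← Finset.sum_fiberwise (s := Finset.univ) (g := T)]
  have key : ∀ c : Fin n → α → Fin (m + 1),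
      ∑ t ∈ Finset.univ.filter (fun t => T t = c), ∏ j, ∏ i, freq t i (t j i) ≤ 1 := by
    intro c
    rcases (Finset.univ.filter (fun t => T t = c)).eq_empty_or_nonempty with h | ⟨t₀, h₀⟩
    · rw [h]; simp
    · have hall : ∑ t : Fin m → Fin n → α, ∏ j, ∏ i, freq t₀ i (t j i) = 1 :=
        sum_pi_pi_prod_eq_one fun i => sum_freq hm t₀ i
      calc ∑ t ∈ Finset.univ.filter (fun t => T t = c), ∏ j, ∏ i, freq t i (t j i)
          = ∑ t ∈ Finset.univ.filter (fun t => T t = c), ∏ j, ∏ i, freq t₀ i (t j i) := by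
            refine Finset.sum_congr rfl fun t ht => ?_
            rw [hT t t₀ ((Finset.mem_filter.1 ht).2.trans (Finset.mem_filter.1 h₀).2.symm)]
        _ ≤ ∑ t : Fin m → Fin n → α, ∏ j, ∏ i, freq t₀ i (t j i) :=
            Finset.sum_le_sum_of_subset_of_nonneg (Finset.filter_subset _ _) fun t _ _ =>
              Finset.prod_nonneg fun j _ => Finset.prod_nonneg fun i _ => freq_nonneg _ _ _
        _ = 1 := hall
  refine (Finset.sum_le_sum fun c _ => key c).trans ?_
  simp [mul_comm n, pow_mul]

/-- The affinity between an empirical law and `p` dominates the geometric mean of the likelihood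
ratios of the sample, by the inequality of arithmetic and geometric means. -/
lemma prod_le_affinity_pow (hm : 0 < m) (t : Fin m → Fin n → α) (i : Fin n) (p : α → ℝ) :
    ∏ j, √(p (t j i) / freq t i (t j i)) ≤ (∑ a, √(freq t i a) * √(p a)) ^ m := by
  have hm' : (m : ℝ) ≠ 0 := by positivity
  have h1 : ∑ a, √(freq t i a) * √(p a) = (∑ j, √(p (t j i) / freq t i (t j i))) / m := by
    rw [← sum_freq_mul t i fun a => √(p a / freq t i a)]
    refine Finset.sum_congr rfl fun a _ => ?_
    rw [Real.sqrt_div' _ (freq_nonneg _ _ _)]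
    rcases (freq_nonneg t i a).eq_or_lt with h | h
    · simp [← h]
    · have hs : 0 < √(freq t i a) := Real.sqrt_pos.2 h
      field_simp
      rw [Real.sq_sqrt h.le, mul_comm]
  have h2 := Real.geom_mean_le_arith_mean_weighted Finset.univ (fun _ : Fin m => (m : ℝ)⁻¹)
    (fun j => √(p (t j i) / freq t i (t j i))) (fun _ _ => by positivity) (by simp [hm'])
    (fun _ _ => Real.sqrt_nonneg _)
  rw [← Finset.mul_sum, inv_mul_eq_div, ← h1] at h2
  calc ∏ j, √(p (t j i) / freq t i (t j i))
      = (∏ j, √(p (t j i) / freq t i (t j i)) ^ ((m : ℝ)⁻¹)) ^ m := by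
        rw [← Finset.prod_pow]
        refine Finset.prod_congr rfl fun j _ => ?_
        rw [← Real.rpow_natCast, ← Real.rpow_mul (Real.sqrt_nonneg _), inv_mul_cancel₀ hm',
          Real.rpow_one]
    _ ≤ _ := pow_le_pow_left₀
        (Finset.prod_nonneg fun j _ => Real.rpow_nonneg (Real.sqrt_nonneg _) _) h2 m

/-- Where the likelihood ratio between the empirical product law and the true one is below `Θ`,
the two product laws are close in total variation. -/
lemma sum_abs_prod_sub_le (hm : 0 < m) {Θ : ℝ} (hΘ : 0 < Θ) {p : Fin n → α → ℝ}
    (hp : ∀ i a, 0 ≤ p i a) (hp1 : ∀ i, ∑ a, p i a = 1) (t : Fin m → Fin n → α)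
    (ht : ∏ j, ∏ i, freq t i (t j i) < Θ * ∏ j, ∏ i, p i (t j i)) :
    ∑ k : Fin n → α, |∏ i, freq t i (k i) - ∏ i, p i (k i)| ≤ 2 * √(Real.log Θ / m) := by
  have hm' : (0 : ℝ) < m := by positivity
  refine (sum_abs_sub_le_affinity
    (fun k => Finset.prod_nonneg fun i _ => freq_nonneg _ _ _)
    (fun k => Finset.prod_nonneg fun i _ => hp _ _)
    (sum_pi_prod_eq_one fun i => sum_freq hm t i) (sum_pi_prod_eq_one (p := p) hp1)).trans ?_
  -- The affinity is multiplicative over product laws.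
  have hB : ∑ k : Fin n → α, √(∏ i, freq t i (k i)) * √(∏ i, p i (k i))
      = ∏ i, ∑ a, √(freq t i a) * √(p i a) := by
    rw [Finset.prod_univ_sum, Fintype.piFinset_univ]
    refine Finset.sum_congr rfl fun k _ => ?_
    rw [Finset.prod_mul_distrib, Real.sqrt_prod _ fun i _ => freq_nonneg _ _ _,
      Real.sqrt_prod _ fun i _ => hp _ _]
  rw [hB]
  set B := ∏ i, ∑ a, √(freq t i a) * √(p i a) with hBdef
  set Q := ∏ j, ∏ i, freq t i (t j i) with hQ
  set P := ∏ j, ∏ i, p i (t j i) with hP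
  have hQ0 : 0 < Q := Finset.prod_pos fun j _ => Finset.prod_pos fun i _ => freq_pos t i j
  have hP0 : 0 < P := by
    by_contra h
    have h' : Θ * P ≤ 0 := mul_nonpos_of_nonneg_of_nonpos hΘ.le (not_lt.1 h)
    linarith
  have hroot : √(P / Q) ≤ B ^ m := by
    rw [hP, hQ, ← Finset.prod_div_distrib]
    simp only [← Finset.prod_div_distrib]
    rw [Finset.prod_comm,
      Real.sqrt_prod _ fun i _ => Finset.prod_nonneg fun j _ => div_nonneg (hp _ _) (freq_nonneg _ _ _),
      hBdef, ← Finset.prod_pow]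
    refine Finset.prod_le_prod (fun _ _ => Real.sqrt_nonneg _) fun i _ => ?_
    rw [Real.sqrt_prod _ fun j _ => div_nonneg (hp _ _) (freq_nonneg _ _ _)]
    exact prod_le_affinity_pow hm t i (p i)
  have hB0 : 0 ≤ B := Finset.prod_nonneg fun i _ => Finset.sum_nonneg fun a _ => by positivity
  have hlow : Θ⁻¹ ≤ (B ^ 2) ^ m := by
    have h1 : Θ⁻¹ ≤ P / Q := by
      rw [le_div_iff₀ hQ0, inv_mul_le_iff₀ hΘ]; exact ht.le
    have h2 : P / Q ≤ (B ^ m) ^ 2 := by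
      rw [← Real.sq_sqrt (div_pos hP0 hQ0).le]
      exact pow_le_pow_left₀ (Real.sqrt_nonneg _) hroot 2
    rw [← pow_mul, mul_comm 2 m, pow_mul]
    exact h1.trans h2
  have hB2 : 0 < B ^ 2 := by
    rcases (sq_nonneg B).eq_or_lt with h | h
    · rw [← h, zero_pow hm.ne'] at hlow
      exact absurd hlow (not_le.2 (inv_pos.2 hΘ))
    · exact h
  have hlog : -Real.log Θ ≤ m * Real.log (B ^ 2) := by
    rw [← Real.log_inv, ← Real.log_pow]
    exact Real.log_le_log (inv_pos.2 hΘ) hlow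
  have : 1 - B ^ 2 ≤ Real.log Θ / m := by
    rw [le_div_iff₀ hm']
    nlinarith [Real.log_le_sub_one_of_pos hB2]
  gcongr

/-- Method of types: the likelihood ratio between the empirical and the true product law exceeds
`Θ` with probability at most the number of types divided by `Θ`. -/
lemma sum_bad_le (hm : 0 < m) {Θ : ℝ} (hΘ : 0 < Θ) (p : Fin n → α → ℝ) :
    ∑ t ∈ Finset.univ.filter (fun t : Fin m → Fin n → α =>
        Θ * ∏ j, ∏ i, p i (t j i) ≤ ∏ j, ∏ i, freq t i (t j i)), ∏ j, ∏ i, p i (t j i)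
      ≤ ((m : ℝ) + 1) ^ (n * Fintype.card α) / Θ := by
  rw [le_div_iff₀ hΘ, mul_comm, Finset.mul_sum]
  calc _ ≤ ∑ t ∈ Finset.univ.filter (fun t : Fin m → Fin n → α =>
        Θ * ∏ j, ∏ i, p i (t j i) ≤ ∏ j, ∏ i, freq t i (t j i)), ∏ j, ∏ i, freq t i (t j i) :=
        Finset.sum_le_sum fun t ht => (Finset.mem_filter.1 ht).2
    _ ≤ ∑ t : Fin m → Fin n → α, ∏ j, ∏ i, freq t i (t j i) :=
        Finset.sum_le_sum_of_subset_of_nonneg (Finset.filter_subset _ _) fun t _ _ =>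
          Finset.prod_nonneg fun j _ => Finset.prod_nonneg fun i _ => freq_nonneg _ _ _
    _ ≤ _ := sum_prod_freq_le hm

end Finite

/-! ### Threshold payments -/

/-- The payment, in units of the grid width, of a bidder who reports level `k` and wins with
probability `g l` at level `l`: each increase of the winning probability is charged at the level
where it occurs. -/
noncomputable def thresholdPay (g : ℕ → ℝ) (k : ℕ) : ℝ :=
  ∑ j ∈ Finset.range k, ((j : ℝ) + 1) * (g (j + 1) - g j)

lemma thresholdPay_succ (g : ℕ → ℝ) (k : ℕ) :
    thresholdPay g (k + 1) = thresholdPay g k + ((k : ℝ) + 1) * (g (k + 1) - g k) :=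
  Finset.sum_range_succ _ _

lemma thresholdPay_nonneg {g : ℕ → ℝ} (hg : Monotone g) (k : ℕ) : 0 ≤ thresholdPay g k :=
  Finset.sum_nonneg fun j _ =>
    mul_nonneg (by positivity) (sub_nonneg.2 (hg (Nat.le_succ j)))

lemma thresholdPay_le {g : ℕ → ℝ} (hg0 : ∀ k, 0 ≤ g k) (k : ℕ) :
    thresholdPay g k ≤ k * g k := by
  induction k with
  | zero => simp [thresholdPay]
  | succ k ih =>
    rw [thresholdPay_succ]
    push_cast
    nlinarith [hg0 k]

/-- Under threshold payments a bidder whose value lies in the cell of level `k` best reports `k`. -/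
lemma thresholdPay_incentive {g : ℕ → ℝ} (hg : Monotone g) {ε t : ℝ} {k : ℕ}
    (h1 : k * ε ≤ t) (h2 : t ≤ (k + 1) * ε) (hε : 0 ≤ ε) (l : ℕ) :
    t * g l - ε * thresholdPay g l ≤ t * g k - ε * thresholdPay g k := by
  have step : ∀ j, t * g (j + 1) - ε * thresholdPay g (j + 1)
      = t * g j - ε * thresholdPay g j + (t - (j + 1) * ε) * (g (j + 1) - g j) := fun j => by
    rw [thresholdPay_succ]; ring
  have hd : ∀ j, 0 ≤ g (j + 1) - g j := fun j => sub_nonneg.2 (hg (Nat.le_succ j))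
  rcases le_total l k with hlk | hkl
  · clear h2
    induction k, hlk using Nat.le_induction with
    | base => exact le_rfl
    | succ k _ ih =>
      push_cast at h1
      rw [step]
      have := ih (by nlinarith)
      nlinarith [mul_nonneg (sub_nonneg.2 h1) (hd k)]
  · induction l, hkl using Nat.le_induction with
    | base => exact le_rfl
    | succ l hl ih =>
      rw [step]
      have hl' : (k : ℝ) ≤ l := by exact_mod_cast hl
      have : t ≤ (l + 1) * ε := h2.trans (by gcongr)
      nlinarith [mul_nonneg (sub_nonneg.2 this) (hd l)]

/-- Threshold payments are the largest incentive compatible ones on the grid, and representatives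
`w l` that exceed their grid point by at most `c` grid widths gain at most `c` grid widths times the
winning probability. -/
lemma pay_le_thresholdPay {X P : ℝ≥0 → ℝ} (hX : ∀ t, 0 ≤ X t)
    (hIC : ∀ t s : ℝ≥0, (t : ℝ) * X s - P s ≤ t * X t - P t)
    (hIR : ∀ t : ℝ≥0, 0 ≤ (t : ℝ) * X t - P t) {ε c : ℝ} {w : ℕ → ℝ≥0} (hw : Monotone w)
    (hwc : ∀ l, (w l : ℝ) ≤ (l + c) * ε) (k : ℕ) :
    P (w k) ≤ ε * thresholdPay (fun l => X (w l)) k + c * ε * X (w k) := by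
  have hXm : Monotone X := by
    intro s t hst
    rcases hst.eq_or_lt with rfl | h
    · exact le_rfl
    · have h' : (s : ℝ) < t := h
      nlinarith [hIC t s, hIC s t]
  induction k with
  | zero =>
    have h0 := hwc 0
    have := mul_le_mul_of_nonneg_right h0 (hX (w 0))
    simp only [thresholdPay, Finset.range_zero, Finset.sum_empty]
    push_cast at this
    nlinarith [hIR (w 0)]
  | succ k ih =>
    rw [thresholdPay_succ]
    have h1 := hIC (w (k + 1)) (w k)
    have h2 := mul_le_mul_of_nonneg_right (hwc (k + 1))
      (sub_nonneg.2 (hXm (hw (Nat.le_succ k))))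
    push_cast at h2
    nlinarith

/-! ### Mechanisms on a grid -/

/-- A monotone allocation rule on profiles of grid levels. -/
structure IsGridAlloc {n : ℕ} (x : (Fin n → ℕ) → Fin n → ℝ) : Prop where
  nonneg : ∀ k i, 0 ≤ x k i
  sum_le_one : ∀ k, ∑ i, x k i ≤ 1
  mono : ∀ k i, Monotone fun a => x (Function.update k i a) i

/-- The threshold payment of bidder `i` at the level profile `k`, in units of the grid width. -/
noncomputable def gridPay {n : ℕ} (x : (Fin n → ℕ) → Fin n → ℝ) (k : Fin n → ℕ) (i : Fin n) : ℝ :=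
  thresholdPay (fun a => x (Function.update k i a) i) (k i)

section Grid

variable {n : ℕ} {x : (Fin n → ℕ) → Fin n → ℝ}

lemma gridPay_nonneg (hx : IsGridAlloc x) (k : Fin n → ℕ) (i : Fin n) : 0 ≤ gridPay x k i :=
  thresholdPay_nonneg (hx.mono k i) _

lemma gridPay_le (hx : IsGridAlloc x) (k : Fin n → ℕ) (i : Fin n) :
    gridPay x k i ≤ k i * x k i := by
  have := thresholdPay_le (g := fun a => x (Function.update k i a) i) (fun a => hx.nonneg _ _) (k i)
  simpa [gridPay] using this

/-- The level of `v` on the grid of width `ε`. -/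
noncomputable def level (ε v : ℝ≥0) : ℕ := ⌊v / ε⌋₊

lemma measurable_level (ε : ℝ≥0) : Measurable (level ε) :=
  Nat.measurable_floor.comp (measurable_id.div_const ε)

lemma roundDown_eq (ε v : ℝ≥0) : roundDown ε v = level ε v * ε := rfl

lemma level_natCast_mul {ε : ℝ≥0} (hε : 0 < ε) (k : ℕ) : level ε (k * ε) = k := by
  simp [level, hε.ne']

lemma level_roundDown {ε : ℝ≥0} (hε : 0 < ε) (v : ℝ≥0) : level ε (roundDown ε v) = level ε v :=
  level_natCast_mul hε _

lemma level_mul_le {ε : ℝ≥0} (hε : 0 < ε) (v : ℝ≥0) : (level ε v : ℝ) * ε ≤ v := by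
  have := (le_div_iff₀ hε).1 (Nat.floor_le (a := v / ε) zero_le)
  exact_mod_cast this

lemma le_level_add_one_mul {ε : ℝ≥0} (hε : 0 < ε) (v : ℝ≥0) :
    (v : ℝ) ≤ (level ε v + 1) * ε := by
  have := ((div_lt_iff₀ hε).1 (Nat.lt_floor_add_one (v / ε))).le
  exact_mod_cast this

/-- The mechanism that rounds reports down to the grid, allocates by `x` and charges threshold
payments. -/
noncomputable def gridMech (ε : ℝ≥0) (x : (Fin n → ℕ) → Fin n → ℝ) (hx : IsGridAlloc x) :
    Mechanism n where
  alloc v := x fun i => level ε (v i)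
  pay v i := ε * gridPay x (fun i => level ε (v i)) i
  alloc_nonneg _ _ := hx.nonneg _ _
  alloc_sum_le_one _ := hx.sum_le_one _
  measurable_alloc := (measurable_of_countable x).comp
    (measurable_pi_lambda _ fun i => (measurable_level ε).comp (measurable_pi_apply i))
  measurable_pay := (measurable_of_countable fun k i => (ε : ℝ) * gridPay x k i).comp
    (measurable_pi_lambda _ fun i => (measurable_level ε).comp (measurable_pi_apply i))

lemma level_update (ε : ℝ≥0) (v : Fin n → ℝ≥0) (i : Fin n) (w : ℝ≥0) :
    (fun j => level ε (Function.update v i w j))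
      = Function.update (fun j => level ε (v j)) i (level ε w) := by
  funext j
  exact Function.apply_update (fun _ => level ε) v i w j

lemma gridMech_isDSIC {ε : ℝ≥0} (hε : 0 < ε) (hx : IsGridAlloc x) :
    (gridMech ε x hx).IsDSIC := by
  intro v i w
  have := thresholdPay_incentive (hx.mono (fun j => level ε (v j)) i) (level_mul_le hε (v i))
    (le_level_add_one_mul hε (v i)) ε.coe_nonneg (level ε w)
  simp only [Mechanism.utility, gridMech, level_update, gridPay]
  simpa using this

lemma gridMech_isIR {ε : ℝ≥0} (hε : 0 < ε) (hx : IsGridAlloc x) :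
    (gridMech ε x hx).IsIR := by
  intro v i
  simp only [Mechanism.utility, gridMech]
  have h1 := gridPay_le hx (fun j => level ε (v j)) i
  have h2 := level_mul_le hε (v i)
  have h3 := hx.nonneg (fun j => level ε (v j)) i
  nlinarith [ε.coe_nonneg, mul_le_mul_of_nonneg_left h1 ε.coe_nonneg,
    mul_le_mul_of_nonneg_right h2 h3]

lemma sum_gridPay_nonneg (ε : ℝ≥0) (hx : IsGridAlloc x) (k : Fin n → ℕ) :
    0 ≤ ∑ i, (ε : ℝ) * gridPay x k i :=
  Finset.sum_nonneg fun i _ => mul_nonneg ε.coe_nonneg (gridPay_nonneg hx k i)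

lemma sum_gridPay_le {ε : ℝ≥0} {h : ℝ} (hx : IsGridAlloc x) (h0 : 0 ≤ h) (k : Fin n → ℕ)
    (hk : ∀ i, (k i : ℝ) * ε ≤ h) : ∑ i, (ε : ℝ) * gridPay x k i ≤ h := by
  calc ∑ i, (ε : ℝ) * gridPay x k i ≤ ∑ i, h * x k i := by
        refine Finset.sum_le_sum fun i _ => ?_
        nlinarith [mul_le_mul_of_nonneg_left (gridPay_le hx k i) ε.coe_nonneg,
          mul_le_mul_of_nonneg_right (hk i) (hx.nonneg k i)]
    _ = h * ∑ i, x k i := by rw [Finset.mul_sum]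
    _ ≤ h * 1 := mul_le_mul_of_nonneg_left (hx.sum_le_one k) h0
    _ = h := mul_one h

lemma isCompact_isGridAlloc (n : ℕ) :
    IsCompact {x : (Fin n → ℕ) → Fin n → ℝ | IsGridAlloc x} := by
  have hbox : IsCompact (Set.univ.pi fun _ : Fin n → ℕ =>
      Set.univ.pi fun _ : Fin n => Set.Icc (0 : ℝ) 1) :=
    isCompact_univ_pi fun _ => isCompact_univ_pi fun _ => isCompact_Icc
  have hc : ∀ k i, Continuous fun x : (Fin n → ℕ) → Fin n → ℝ => x k i := fun k i =>
    (continuous_apply i).comp (continuous_apply k)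
  refine hbox.of_isClosed_subset ?_ ?_
  · have : {x : (Fin n → ℕ) → Fin n → ℝ | IsGridAlloc x}
        = {x | ∀ k i, 0 ≤ x k i} ∩ {x | ∀ k, ∑ i, x k i ≤ 1} ∩
          {x | ∀ k i a b, a ≤ b →
            x (Function.update k i a) i ≤ x (Function.update k i b) i} := by
      ext x
      exact ⟨fun h => ⟨⟨h.nonneg, h.sum_le_one⟩, fun k i a b hab => h.mono k i hab⟩,
        fun h => ⟨h.1.1, h.1.2, fun k i a b hab => h.2 k i a b hab⟩⟩
    rw [this]
    simp only [Set.ofPred_forall]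
    refine (IsClosed.inter ?_ ?_).inter ?_
    · exact isClosed_iInter fun k => isClosed_iInter fun i =>
        isClosed_le continuous_const (hc k i)
    · exact isClosed_iInter fun k =>
        isClosed_le (continuous_finsetSum _ fun i _ => hc k i) continuous_const
    · exact isClosed_iInter fun k => isClosed_iInter fun i => isClosed_iInter fun a =>
        isClosed_iInter fun b => isClosed_iInter fun _ => isClosed_le (hc _ i) (hc _ i)
  · intro x hx k _ i _
    exact ⟨hx.nonneg k i,
      (Finset.single_le_sum (fun j _ => hx.nonneg k j) (Finset.mem_univ i)).trans
        (hx.sum_le_one k)⟩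

lemma isGridAlloc_zero (n : ℕ) : IsGridAlloc (0 : (Fin n → ℕ) → Fin n → ℝ) :=
  ⟨by simp, by simp, fun _ _ => monotone_const⟩

/-- The revenue of a grid allocation, in units of value, when the levels of the bidders are
independent and bidder `i` has level `a ≤ K` with probability `q i a`. -/
noncomputable def gridRev {K : ℕ} (ε : ℝ≥0) (x : (Fin n → ℕ) → Fin n → ℝ)
    (q : Fin n → Fin (K + 1) → ℝ) : ℝ :=
  ∑ k : Fin n → Fin (K + 1), (∏ i, q i (k i)) * ∑ i, (ε : ℝ) * gridPay x (fun j => k j) i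

lemma exists_gridRev_max {K : ℕ} (ε : ℝ≥0) (q : Fin n → Fin (K + 1) → ℝ) :
    ∃ x : (Fin n → ℕ) → Fin n → ℝ, IsGridAlloc x ∧
      ∀ y, IsGridAlloc y → gridRev ε y q ≤ gridRev ε x q := by
  have hcont : Continuous fun x : (Fin n → ℕ) → Fin n → ℝ => gridRev ε x q := by
    unfold gridRev gridPay thresholdPay
    fun_prop
  obtain ⟨x, hx, hmax⟩ := (isCompact_isGridAlloc n).exists_isMaxOn
    ⟨0, isGridAlloc_zero n⟩ hcont.continuousOn
  exact ⟨x, hx, fun y hy => hmax hy⟩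

/-- Restricting a DSIC and IR mechanism to representatives of the grid levels, and charging
threshold payments, loses at most `c` grid widths of revenue at every profile. -/
lemma exists_gridAlloc_of_mechanism (M : Mechanism n) (hIC : M.IsDSIC) (hIR : M.IsIR)
    {ε : ℝ≥0} {c : ℝ} (hc : 0 ≤ c) {w : Fin n → ℕ → ℝ≥0} (hw : ∀ i, Monotone (w i))
    (hwc : ∀ i l, (w i l : ℝ) ≤ (l + c) * ε) :
    ∃ x : (Fin n → ℕ) → Fin n → ℝ, IsGridAlloc x ∧ ∀ k : Fin n → ℕ,
      ∑ i, M.pay (fun j => w j (k j)) i ≤ ∑ i, (ε : ℝ) * gridPay x k i + c * ε := by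
  have hIC' : ∀ (v : Fin n → ℝ≥0) i (t s : ℝ≥0),
      (t : ℝ) * M.alloc (Function.update v i s) i - M.pay (Function.update v i s) i
        ≤ t * M.alloc (Function.update v i t) i - M.pay (Function.update v i t) i := by
    intro v i t s
    simpa [Mechanism.utility] using hIC (Function.update v i t) i s
  have hIR' : ∀ (v : Fin n → ℝ≥0) i (t : ℝ≥0),
      0 ≤ (t : ℝ) * M.alloc (Function.update v i t) i - M.pay (Function.update v i t) i := by
    intro v i t
    simpa [Mechanism.utility] using hIR (Function.update v i t) i
  have hup : ∀ (k : Fin n → ℕ) i a, (fun j => w j (Function.update k i a j))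
      = Function.update (fun j => w j (k j)) i (w i a) := fun k i a =>
    funext fun j => Function.apply_update w k i a j
  refine ⟨fun k => M.alloc fun j => w j (k j), ⟨fun _ _ => M.alloc_nonneg _ _,
    fun _ => M.alloc_sum_le_one _, ?_⟩, ?_⟩
  · intro k i a b hab
    simp only [hup]
    have hab' := hw i hab
    rcases hab'.eq_or_lt with h | h
    · rw [h]
    · have h' : (w i a : ℝ) < w i b := h
      have := hIC' (fun j => w j (k j)) i
      nlinarith [this (w i a) (w i b), this (w i b) (w i a)]
  · intro k
    have hi : ∀ i, M.pay (fun j => w j (k j)) i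
        ≤ ε * gridPay (fun k => M.alloc fun j => w j (k j)) k i
          + c * ε * M.alloc (fun j => w j (k j)) i := by
      intro i
      have := pay_le_thresholdPay
        (X := fun t => M.alloc (Function.update (fun j => w j (k j)) i t) i)
        (P := fun t => M.pay (Function.update (fun j => w j (k j)) i t) i)
        (fun t => M.alloc_nonneg _ _) (hIC' _ i) (hIR' _ i) (hw i) (hwc i) (k i)
      have hself : Function.update (fun j => w j (k j)) i (w i (k i)) = fun j => w j (k j) :=
        Function.update_eq_self i _
      simp only [hself] at this
      simpa only [gridPay, hup] using this
    calc _ ≤ ∑ i, (ε * gridPay (fun k => M.alloc fun j => w j (k j)) k i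
          + c * ε * M.alloc (fun j => w j (k j)) i) := Finset.sum_le_sum fun i _ => hi i
      _ = ∑ i, ε * gridPay (fun k => M.alloc fun j => w j (k j)) k i
          + c * ε * ∑ i, M.alloc (fun j => w j (k j)) i := by
        rw [Finset.sum_add_distrib, Finset.mul_sum]
      _ ≤ _ := by
        have := mul_le_mul_of_nonneg_left (M.alloc_sum_le_one fun j => w j (k j))
          (mul_nonneg hc ε.coe_nonneg)
        linarith

end Grid

/-! ### Discretized product measures -/

section Discretize

variable {ι X α : Type*} [Fintype ι] [MeasurableSpace X]
  {D : ι → Measure X} [∀ i, IsProbabilityMeasure (D i)] {idx : X → α}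

lemma real_pi_fiber (k : ι → α) :
    (Measure.pi D).real ((fun v i => idx (v i)) ⁻¹' {k}) = ∏ i, (D i).real (idx ⁻¹' {k i}) := by
  have : (fun (v : ι → X) i => idx (v i)) ⁻¹' {k} = Set.univ.pi fun i => idx ⁻¹' {k i} := by
    ext v
    simp [funext_iff]
  rw [this, Measure.real, Measure.pi_pi, ENNReal.toReal_prod]
  rfl

variable [DecidableEq ι] [Fintype α] [MeasurableSpace α] [MeasurableSingletonClass α]

/-- The expectation of a function of the labels is a finite sum over label profiles. -/
lemma integral_pi_comp_label (hidx : Measurable idx) (f : (ι → α) → ℝ) :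
    ∫ v, f (fun i => idx (v i)) ∂(Measure.pi D)
      = ∑ k : ι → α, (∏ i, (D i).real (idx ⁻¹' {k i})) * f k := by
  classical
  have hm : Measurable fun (v : ι → X) i => idx (v i) :=
    measurable_pi_lambda _ fun i => hidx.comp (measurable_pi_apply i)
  rw [← integral_map (φ := fun (v : ι → X) i => idx (v i)) hm.aemeasurable
    (measurable_of_countable f).aestronglyMeasurable]
  have : IsProbabilityMeasure ((Measure.pi D).map fun (v : ι → X) i => idx (v i)) :=
    Measure.isProbabilityMeasure_map hm.aemeasurable
  rw [integral_fintype (Integrable.of_finite)]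
  refine Finset.sum_congr rfl fun k _ => ?_
  rw [map_measureReal_apply hm (measurableSet_singleton k), real_pi_fiber, smul_eq_mul]

/-- Drawing representatives of the labels from the conditional laws turns the expectation under
the product measure into a finite sum over label profiles; some choice of representatives does at
least as well as the average one. The point `r a` represents labels of probability zero. -/
lemma exists_representatives (hidx : Measurable idx) {G : Set X}
    (hG : ∀ i, ∀ᵐ v ∂(D i), v ∈ G) {r : α → X} (hrG : ∀ a, r a ∈ G) (hr : ∀ a, idx (r a) = a)
    [MeasurableSingletonClass X] {P : (ι → X) → ℝ} (hP : Integrable P (Measure.pi D)) :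
    ∃ w : ι → α → X, (∀ i a, w i a ∈ G ∧ idx (w i a) = a) ∧
      ∫ v, P v ∂(Measure.pi D)
        ≤ ∑ k : ι → α, (∏ i, (D i).real (idx ⁻¹' {k i})) * P fun i => w i (k i) := by
  classical
  let c : ι → α → ℝ≥0∞ := fun i a => D i (idx ⁻¹' {a})
  let κ : ι → α → Measure X := fun i a =>
    if c i a = 0 then Measure.dirac (r a) else ProbabilityTheory.cond (D i) (idx ⁻¹' {a})
  have hS : ∀ a, MeasurableSet (idx ⁻¹' {a}) := fun a => hidx (measurableSet_singleton a)
  have hκ : ∀ i a, IsProbabilityMeasure (κ i a) := by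
    intro i a
    by_cases h : c i a = 0
    · simp only [κ, h, if_true]; infer_instance
    · simp only [κ, h, if_false]; exact ProbabilityTheory.cond_isProbabilityMeasure h
  have hκG : ∀ i a, ∀ᵐ x ∂(κ i a), x ∈ G ∧ idx x = a := by
    intro i a
    by_cases h : c i a = 0
    · simp only [κ, h, if_true, ae_dirac_eq, Filter.eventually_pure]
      exact ⟨hrG a, hr a⟩
    · simp only [κ, h, if_false]
      filter_upwards [ProbabilityTheory.cond_absolutelyContinuous.ae_le (hG i),
        ProbabilityTheory.ae_cond_mem (hS a)] with x h1 h2 using ⟨h1, h2⟩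
  have hrestr : ∀ i a, (D i).restrict (idx ⁻¹' {a}) = c i a • κ i a := by
    intro i a
    by_cases h : c i a = 0
    · rw [h, zero_smul, Measure.restrict_eq_zero]; exact h
    · simp only [κ, h, if_false, ProbabilityTheory.cond, smul_smul]
      rw [ENNReal.mul_inv_cancel h (measure_ne_top _ _), one_smul]
  have hbox : ∀ k : ι → α, (Measure.pi D).restrict (Set.univ.pi fun i => idx ⁻¹' {k i})
      = (∏ i, c i (k i)) • Measure.pi fun i => κ i (k i) := by
    intro k
    rw [Measure.restrict_pi_pi]
    refine Measure.pi_eq fun s _ => ?_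
    simp only [hrestr, Measure.smul_apply, Measure.pi_pi, smul_eq_mul, Finset.prod_mul_distrib]
  have hcreal : ∀ k : ι → α, (∏ i, c i (k i)).toReal = ∏ i, (D i).real (idx ⁻¹' {k i}) :=
    fun k => ENNReal.toReal_prod _ _
  have hctop : ∀ k : ι → α, (∏ i, c i (k i)) ≠ ∞ :=
    fun k => ENNReal.prod_ne_top fun i _ => measure_ne_top _ _
  -- Splitting the integral over the boxes on which all labels are fixed.
  have hsplit : ∫ v, P v ∂(Measure.pi D)
      = ∑ k : ι → α, (∏ i, (D i).real (idx ⁻¹' {k i})) *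
          ∫ v, P v ∂(Measure.pi fun i => κ i (k i)) := by
    have hU : (⋃ k : ι → α, Set.univ.pi fun i => idx ⁻¹' {k i}) = Set.univ := by
      refine Set.eq_univ_of_forall fun v => Set.mem_iUnion.2 ⟨fun i => idx (v i), ?_⟩
      simp
    rw [← setIntegral_univ, ← hU, integral_iUnion_fintype
      (s := fun k : ι → α => Set.univ.pi fun i => idx ⁻¹' {k i}) (fun k => MeasurableSet.univ_pi fun i => hS (k i)) ?_ (fun k => hP.integrableOn)]
    · refine Finset.sum_congr rfl fun k _ => ?_
      rw [hbox, integral_smul_measure, hcreal, smul_eq_mul]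
    · intro k l hkl
      refine Set.disjoint_left.2 fun v hv hv' => hkl (funext fun i => ?_)
      have h1 : idx (v i) = k i := hv i trivial
      have h2 : idx (v i) = l i := hv' i trivial
      rw [← h1, h2]
  let W : Measure (ι → α → X) := Measure.pi fun i => Measure.pi (κ i)
  have hmp : ∀ k : ι → α, MeasurePreserving (fun (w : ι → α → X) i => w i (k i)) W
      (Measure.pi fun i => κ i (k i)) := fun k =>
    measurePreserving_pi (fun i => Measure.pi (κ i)) (fun i => κ i (k i))
      (f := fun i u => u (k i)) fun i => measurePreserving_eval (κ i) (k i)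
  have hint : ∀ k : ι → α, (∏ i, c i (k i)) ≠ 0 →
      Integrable P (Measure.pi fun i => κ i (k i)) := by
    intro k hk
    rw [← integrable_smul_measure hk (hctop k), ← hbox]
    exact hP.restrict
  have hint' : ∀ k : ι → α, Integrable
      (fun w : ι → α → X => (∏ i, (D i).real (idx ⁻¹' {k i})) * P fun i => w i (k i)) W := by
    intro k
    by_cases hk : (∏ i, c i (k i)) = 0
    · rw [← hcreal, hk]; simp
    · exact (((hmp k).integrable_comp (hint k hk).1).2 (hint k hk)).const_mul _
  have htotal : ∫ w, ∑ k : ι → α, (∏ i, (D i).real (idx ⁻¹' {k i})) * P (fun i => w i (k i)) ∂W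
      = ∫ v, P v ∂(Measure.pi D) := by
    rw [integral_finsetSum _ fun k _ => hint' k, hsplit]
    refine Finset.sum_congr rfl fun k _ => ?_
    by_cases hk : (∏ i, c i (k i)) = 0
    · rw [← hcreal, hk]; simp
    · rw [integral_const_mul, ← (hmp k).map_eq, integral_map (hmp k).measurable.aemeasurable]
      rw [(hmp k).map_eq]; exact (hint k hk).1
  have hgood : ∀ᵐ w ∂W, ∀ i a, w i a ∈ G ∧ idx (w i a) = a := by
    refine ae_all_iff.2 fun i => ae_all_iff.2 fun a => ?_
    have h1 : ∀ᵐ u ∂(Measure.pi (κ i)), u a ∈ G ∧ idx (u a) = a :=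
      (measurePreserving_eval (κ i) a).quasiMeasurePreserving.ae (hκG i a)
    exact (measurePreserving_eval (fun i => Measure.pi (κ i)) i).quasiMeasurePreserving.ae h1
  obtain ⟨w, hw, hle⟩ := exists_notMem_null_integral_le
    (integrable_finsetSum Finset.univ fun k _ => hint' k) hgood
  refine ⟨w, ?_, htotal ▸ hle⟩
  simpa using hw

end Discretize

/-! ### Revenue of grid mechanisms and of arbitrary mechanisms -/

lemma level_mono (ε : ℝ≥0) : Monotone (level ε) := fun v w hvw =>
  Nat.floor_mono (by gcongr)

/-- The level of `v` on the grid of width `ε`, capped at `K`. -/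
noncomputable def capLevel (ε : ℝ≥0) (K : ℕ) (v : ℝ≥0) : Fin (K + 1) :=
  ⟨min (level ε v) K, Nat.lt_succ_of_le (min_le_right _ _)⟩

lemma measurable_capLevel (ε : ℝ≥0) (K : ℕ) : Measurable (capLevel ε K) :=
  (measurable_of_countable fun l : ℕ =>
    (⟨min l K, Nat.lt_succ_of_le (min_le_right _ _)⟩ : Fin (K + 1))).comp (measurable_level ε)

lemma coe_capLevel {ε h v : ℝ≥0} (hv : v ≤ h) : (capLevel ε (level ε h) v : ℕ) = level ε v :=
  min_eq_left (level_mono ε hv)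

lemma capLevel_roundDown {ε : ℝ≥0} (hε : 0 < ε) (K : ℕ) (v : ℝ≥0) :
    capLevel ε K (roundDown ε v) = capLevel ε K v := by
  simp only [capLevel, level_roundDown hε]

lemma capLevel_natCast_mul {ε : ℝ≥0} (hε : 0 < ε) {K : ℕ} (a : Fin (K + 1)) :
    capLevel ε K (((a : ℕ) : ℝ≥0) * ε) = a := by
  ext
  simp only [capLevel, level_natCast_mul hε]
  omega

lemma ae_forall_pi {n : ℕ} {D : Fin n → Measure ℝ≥0} [∀ i, IsProbabilityMeasure (D i)]
    {p : ℝ≥0 → Prop} (hp : ∀ i, ∀ᵐ v ∂(D i), p v) : ∀ᵐ v ∂(Measure.pi D), ∀ i, p (v i) :=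
  ae_all_iff.2 fun i => Measure.tendsto_eval_ae_ae.eventually (hp i)

/-- The probabilities of the grid levels up to that of `h` under the laws `D i`. -/
noncomputable def levelProb {n : ℕ} (ε h : ℝ≥0) (D : Fin n → Measure ℝ≥0) (i : Fin n)
    (a : Fin (level ε h + 1)) : ℝ :=
  (D i).real (capLevel ε (level ε h) ⁻¹' {a})

section Revenue

variable {n : ℕ} {ε h : ℝ≥0} {D : Fin n → Measure ℝ≥0}
  {x : (Fin n → ℕ) → Fin n → ℝ}

lemma levelProb_nonneg (i : Fin n) (a : Fin (level ε h + 1)) : 0 ≤ levelProb ε h D i a :=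
  measureReal_nonneg

lemma rev_gridMech_nonneg (hx : IsGridAlloc x) (μ : Measure (Fin n → ℝ≥0)) :
    0 ≤ (gridMech ε x hx).rev μ :=
  integral_nonneg fun _ => sum_gridPay_nonneg ε hx _

lemma optRev_le {μ : Measure (Fin n → ℝ≥0)} {b : ℝ} {M : Mechanism n} (hM : M.IsAdmissible μ)
    (hb : ∀ M : Mechanism n, M.IsAdmissible μ → M.rev μ ≤ b) : optRev μ ≤ b := by
  refine csSup_le ⟨M.rev μ, M, hM, rfl⟩ ?_
  rintro r ⟨M', hM', rfl⟩
  exact hb M' hM'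

/-- The revenue of a grid mechanism is Lipschitz in the product law for total variation. -/
lemma gridRev_le_add (hε : 0 < ε) (hx : IsGridAlloc x)
    (p q : Fin n → Fin (level ε h + 1) → ℝ) :
    gridRev ε x p ≤ gridRev ε x q
      + h * ∑ k : Fin n → Fin (level ε h + 1), |∏ i, p i (k i) - ∏ i, q i (k i)| := by
  unfold gridRev
  rw [Finset.mul_sum, ← Finset.sum_add_distrib]
  refine Finset.sum_le_sum fun k _ => ?_
  have h0 := sum_gridPay_nonneg ε hx fun j => (k j : ℕ)
  have h1 : ∑ i, (ε : ℝ) * gridPay x (fun j => (k j : ℕ)) i ≤ h := by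
    refine sum_gridPay_le hx h.coe_nonneg _ fun i => ?_
    have h2 : ((k i : ℕ) : ℝ) ≤ level ε h := by exact_mod_cast Nat.le_of_lt_succ (k i).2
    exact (mul_le_mul_of_nonneg_right h2 ε.coe_nonneg).trans (level_mul_le hε h)
  set y := ∑ i, (ε : ℝ) * gridPay x (fun j => (k j : ℕ)) i
  set d := ∏ i, p i (k i) - ∏ i, q i (k i) with hd
  have h3 : d * y ≤ |d| * h :=
    (mul_le_mul_of_nonneg_right (le_abs_self d) h0).trans
      (mul_le_mul_of_nonneg_left h1 (abs_nonneg d))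
  have : ∏ i, p i (k i) = ∏ i, q i (k i) + d := by rw [hd]; ring
  rw [this, add_mul]
  linarith

variable [∀ i, IsProbabilityMeasure (D i)]

lemma sum_levelProb (i : Fin n) : ∑ a, levelProb ε h D i a = 1 := by
  have := sum_measureReal_preimage_singleton (μ := D i) (f := capLevel ε (level ε h)) Finset.univ
    (fun a _ => measurable_capLevel _ _ (measurableSet_singleton a))
  simpa [levelProb] using this

lemma gridMech_isAdmissible (hε : 0 < ε) (hx : IsGridAlloc x)
    (hD : ∀ i, ∀ᵐ v ∂(D i), v ≤ h) : (gridMech ε x hx).IsAdmissible (Measure.pi D) := by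
  refine ⟨gridMech_isDSIC hε hx, gridMech_isIR hε hx, ?_⟩
  refine Integrable.of_bound (Finset.measurable_sum _ fun i _ =>
    (measurable_pi_apply i).comp (gridMech ε x hx).measurable_pay).aestronglyMeasurable h ?_
  filter_upwards [ae_forall_pi hD] with v hv
  have h0 : 0 ≤ ∑ i, (gridMech ε x hx).pay v i := sum_gridPay_nonneg ε hx _
  rw [Real.norm_of_nonneg h0]
  refine sum_gridPay_le hx h.coe_nonneg _ fun i => ?_
  exact (level_mul_le hε (v i)).trans (NNReal.coe_le_coe.2 (hv i))

lemma rev_gridMech (hx : IsGridAlloc x) (hD : ∀ i, ∀ᵐ v ∂(D i), v ≤ h) :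
    (gridMech ε x hx).rev (Measure.pi D) = gridRev ε x (levelProb ε h D) := by
  unfold gridRev levelProb
  rw [← integral_pi_comp_label (measurable_capLevel _ _)
    fun k => ∑ i, (ε : ℝ) * gridPay x (fun j => (k j : ℕ)) i]
  refine integral_congr_ae ?_
  filter_upwards [ae_forall_pi hD] with v hv
  have : (fun j => (capLevel ε (level ε h) (v j) : ℕ)) = fun j => level ε (v j) :=
    funext fun j => coe_capLevel (hv j)
  simp only [gridMech, this]

/-- A DSIC and IR mechanism earns at most `c` grid widths more than some grid mechanism, if values
exceed their grid point by at most `c` grid widths. -/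
lemma exists_gridRev_ge (hε : 0 < ε) {c : ℝ} (hc0 : 0 ≤ c) (hc1 : c ≤ 1)
    (hD : ∀ i, ∀ᵐ v ∂(D i), v ≤ h ∧ (v : ℝ) ≤ (level ε v + c) * ε)
    (M : Mechanism n) (hM : M.IsAdmissible (Measure.pi D)) :
    ∃ x : (Fin n → ℕ) → Fin n → ℝ, IsGridAlloc x ∧
      M.rev (Measure.pi D) ≤ gridRev ε x (levelProb ε h D) + c * ε := by
  set K := level ε h with hK
  have hKh : ∀ a : Fin (K + 1), ((a : ℕ) : ℝ≥0) * ε ≤ h := fun a => by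
    have h1 := level_mul_le hε h
    have h2 : ((a : ℕ) : ℝ) ≤ K := by exact_mod_cast Nat.le_of_lt_succ a.2
    rw [← NNReal.coe_le_coe]
    push_cast
    exact (mul_le_mul_of_nonneg_right h2 ε.coe_nonneg).trans h1
  obtain ⟨w, hw, hle⟩ := exists_representatives (D := D) (measurable_capLevel ε K)
    (G := {v | v ≤ h ∧ (v : ℝ) ≤ (level ε v + c) * ε}) hD
    (r := fun a => ((a : ℕ) : ℝ≥0) * ε)
    (fun a => ⟨hKh a, by
      rw [level_natCast_mul hε]; push_cast
      nlinarith [mul_nonneg hc0 ε.coe_nonneg]⟩)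
    (capLevel_natCast_mul hε) hM.2.2
  have hlev : ∀ i a, level ε (w i a) = a := fun i a => by
    rw [← coe_capLevel (hw i a).1.1, ← hK, (hw i a).2]
  -- Levels above `K` have probability zero and are represented by their grid points.
  let w' : Fin n → ℕ → ℝ≥0 := fun i l => if hl : l < K + 1 then w i ⟨l, hl⟩ else l * ε
  have hlow : ∀ i (l : ℕ), (l : ℝ) * ε ≤ w' i l := by
    intro i l
    by_cases hl : l < K + 1
    · simp only [w', hl, dif_pos]
      have := level_mul_le hε (w i ⟨l, hl⟩)
      rwa [hlev] at this
    · simp only [w', hl, dif_neg, not_false_eq_true]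
      push_cast
      exact le_rfl
  have hup : ∀ i l, (w' i l : ℝ) ≤ (l + c) * ε := by
    intro i l
    by_cases hl : l < K + 1
    · simp only [w', hl, dif_pos]
      have := (hw i ⟨l, hl⟩).1.2
      rwa [hlev] at this
    · simp only [w', hl, dif_neg, not_false_eq_true]
      push_cast
      nlinarith [mul_nonneg hc0 ε.coe_nonneg]
  have hmono : ∀ i, Monotone (w' i) := fun i => monotone_nat_of_le_succ fun l => by
    rw [← NNReal.coe_le_coe]
    refine (hup i l).trans (le_trans ?_ (hlow i (l + 1)))
    push_cast
    gcongr
  obtain ⟨x, hx, hxM⟩ := exists_gridAlloc_of_mechanism M hM.1 hM.2.1 hc0 hmono hup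
  refine ⟨x, hx, hle.trans ?_⟩
  have hsum : ∑ k : Fin n → Fin (K + 1), ∏ i, levelProb ε h D i (k i) = 1 :=
    sum_pi_prod_eq_one (p := levelProb ε h D) sum_levelProb
  calc _ ≤ ∑ k : Fin n → Fin (K + 1), (∏ i, levelProb ε h D i (k i)) *
        (∑ i, (ε : ℝ) * gridPay x (fun j => k j) i + c * ε) := by
        refine Finset.sum_le_sum fun k _ => mul_le_mul_of_nonneg_left ?_
          (Finset.prod_nonneg fun i _ => levelProb_nonneg _ _)
        have hwk : (fun j => w' j (k j : ℕ)) = fun j => w j (k j) :=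
          funext fun j => by simp only [w', dif_pos (k j).2]
        have := hxM fun j => (k j : ℕ)
        rwa [hwk] at this
    _ = gridRev ε x (levelProb ε h D) + c * ε := by
        simp only [mul_add, Finset.sum_add_distrib, ← Finset.sum_mul, hsum, one_mul]
        rfl

lemma rev_le_of_isAdmissible (hD : ∀ i, ∀ᵐ v ∂(D i), v ≤ h) (M : Mechanism n)
    (hM : M.IsAdmissible (Measure.pi D)) : M.rev (Measure.pi D) ≤ h := by
  have : ∀ᵐ v ∂(Measure.pi D), ∑ i, M.pay v i ≤ (h : ℝ) := by
    filter_upwards [ae_forall_pi hD] with v hv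
    calc ∑ i, M.pay v i ≤ ∑ i, (h : ℝ) * M.alloc v i := by
          refine Finset.sum_le_sum fun i _ => ?_
          have h1 := hM.2.1 v i
          have h2 := mul_le_mul_of_nonneg_right (NNReal.coe_le_coe.2 (hv i)) (M.alloc_nonneg v i)
          simp only [Mechanism.utility] at h1
          linarith
      _ = h * ∑ i, M.alloc v i := by rw [Finset.mul_sum]
      _ ≤ h * 1 := mul_le_mul_of_nonneg_left (M.alloc_sum_le_one v) h.coe_nonneg
      _ = h := mul_one _
  calc M.rev (Measure.pi D) ≤ ∫ _, (h : ℝ) ∂(Measure.pi D) :=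
        integral_mono_ae hM.2.2 (integrable_const _) this
    _ = h := by simp

end Revenue

/-! ### The empirical product law -/

section Empirical

variable {m n : ℕ}

lemma isProbabilityMeasure_empirical (hm : 0 < m) (s : Fin m → Fin n → ℝ≥0) (i : Fin n) :
    IsProbabilityMeasure (empirical s i) := by
  have h0 : (m : ℝ≥0∞) ≠ 0 := by exact_mod_cast hm.ne'
  constructor
  simp [empirical, ENNReal.inv_mul_cancel h0 (ENNReal.natCast_ne_top m)]

lemma ae_empirical {s : Fin m → Fin n → ℝ≥0} {i : Fin n} {p : ℝ≥0 → Prop}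
    (hp : ∀ j, p (s j i)) : ∀ᵐ v ∂(empirical s i), p v := by
  refine Measure.ae_smul_measure ?_ _
  rw [ae_iff, Measure.finsetSum_apply]
  refine Finset.sum_eq_zero fun j _ => ?_
  have : ∀ᵐ v ∂(Measure.dirac (s j i)), p v := by
    rw [ae_dirac_eq]
    exact hp j
  exact this

lemma levelProb_empirical (ε h : ℝ≥0) (s : Fin m → Fin n → ℝ≥0) :
    levelProb ε h (empirical s) = freq fun j i => capLevel ε (level ε h) (s j i) := by
  funext i a
  have hS : MeasurableSet (capLevel ε (level ε h) ⁻¹' {a}) :=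
    measurable_capLevel _ _ (measurableSet_singleton a)
  unfold levelProb freq empirical
  rw [Measure.real, Measure.smul_apply, Measure.finsetSum_apply, smul_eq_mul, ENNReal.toReal_mul]
  have hj : ∀ j, Measure.dirac (s j i) (capLevel ε (level ε h) ⁻¹' {a})
      = if capLevel ε (level ε h) (s j i) = a then (1 : ℝ≥0∞) else 0 := fun j => by
    rw [Measure.dirac_apply' _ hS]
    by_cases hja : capLevel ε (level ε h) (s j i) = a <;> simp [hja]
  simp only [hj, Finset.sum_boole]
  simp [div_eq_inv_mul]

end Empirical

/-! ### Sample complexity -/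

/-- The sample size absorbs the logarithm of the number of types, `(m + 1) ^ (n * (K + 1))`,
although that logarithm grows with `m`. -/
lemma log_types_div_le {n m K : ℕ} {a γ : ℝ} (hm : 0 < m) (ha : 1 ≤ a) (hK : (K : ℝ) ≤ a)
    (hγ0 : 0 < γ)
    (hγ1 : γ < 1)
    (h : a ^ 2 * (n * a * Real.log (2 + n * a) + Real.log (1 / γ)) ≤ m) :
    Real.log (((m : ℝ) + 1) ^ (n * (K + 1)) / γ) / m ≤ 9 / a ^ 2 := by
  have hm' : (0 : ℝ) < m := by positivity
  have ha2 : 0 < a ^ 2 := by positivity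
  have hG : 0 ≤ Real.log (1 / γ) := Real.log_nonneg (by rw [one_le_div hγ0]; exact hγ1.le)
  have hGe : Real.log (1 / γ) = -Real.log γ := by rw [one_div, Real.log_inv]
  rw [Real.log_div (by positivity) hγ0.ne', Real.log_pow, div_le_div_iff₀ hm' ha2,
    sub_eq_add_neg, ← hGe]
  push_cast
  rcases Nat.eq_zero_or_pos n with rfl | hn
  · simp only [Nat.cast_zero, zero_mul, zero_add] at h ⊢
    nlinarith
  have hn' : (1 : ℝ) ≤ n := by exact_mod_cast hn
  set N : ℝ := n * a with hN
  have hN1 : 1 ≤ N := by nlinarith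
  have haN : a ≤ N := by nlinarith
  set L := Real.log (2 + N) with hL
  have hL1 : 1 ≤ L := by
    rw [hL, Real.le_log_iff_exp_le (by linarith)]
    linarith [Real.exp_one_lt_d9]
  have hNL : Real.log N ≤ L := Real.log_le_log (by linarith) (by linarith)
  have haN2 : 0 < a ^ 2 * N := by positivity
  set u : ℝ := m / (a ^ 2 * N) with hu
  have hmu : (m : ℝ) = u * (a ^ 2 * N) := by rw [hu]; field_simp
  have hu0 : 0 < u := by positivity
  have hLu : L ≤ u := by
    rw [hu, le_div_iff₀ haN2]
    nlinarith [mul_nonneg ha2.le hG]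
  have hlog : Real.log ((m : ℝ) + 1) ≤ 4 * u := by
    have hm1 : (1 : ℝ) ≤ m := by exact_mod_cast hm
    have h1 : (m : ℝ) + 1 ≤ 2 * (u * N ^ 3) := by
      have : u * (a ^ 2 * N) ≤ u * N ^ 3 := by
        have : a ^ 2 * N ≤ N ^ 2 * N := by gcongr
        nlinarith
      linarith
    have h2 : Real.log (2 * (u * N ^ 3)) = Real.log 2 + (Real.log u + 3 * Real.log N) := by
      rw [Real.log_mul (by norm_num) (by positivity), Real.log_mul hu0.ne' (by positivity),
        Real.log_pow]
      norm_num
    have h3 := Real.log_le_log (by positivity) h1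
    have h4 := Real.log_le_sub_one_of_pos hu0
    have h5 := Real.log_two_lt_d9
    linarith
  have hK2 : (n : ℝ) * (K + 1) ≤ 2 * N := by nlinarith
  have hprod : (n : ℝ) * (K + 1) * Real.log ((m : ℝ) + 1) ≤ 2 * N * (4 * u) :=
    mul_le_mul hK2 hlog (Real.log_nonneg (by linarith)) (by positivity)
  have h6 : a ^ 2 * Real.log (1 / γ) ≤ m := by
    have : 0 ≤ a ^ 2 * (N * L) := by positivity
    nlinarith
  have h7 : (n : ℝ) * (K + 1) * Real.log ((m : ℝ) + 1) * a ^ 2 ≤ 8 * m := by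
    calc _ ≤ 2 * N * (4 * u) * a ^ 2 := mul_le_mul_of_nonneg_right hprod ha2.le
      _ = 8 * (u * (a ^ 2 * N)) := by ring
      _ = 8 * m := by rw [← hmu]
  nlinarith

/-! ### The learning algorithm -/

/-- A grid allocation of maximal revenue for the product law `q` of the levels. -/
noncomputable def optAlloc {n K : ℕ} (ε : ℝ≥0) (q : Fin n → Fin (K + 1) → ℝ) :
    (Fin n → ℕ) → Fin n → ℝ :=
  (exists_gridRev_max ε q).choose

section Learner

variable {n m : ℕ}

lemma optAlloc_isGridAlloc {K : ℕ} (ε : ℝ≥0) (q : Fin n → Fin (K + 1) → ℝ) :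
    IsGridAlloc (optAlloc ε q) :=
  (exists_gridRev_max ε q).choose_spec.1

lemma gridRev_le_optAlloc {K : ℕ} {ε : ℝ≥0} (q : Fin n → Fin (K + 1) → ℝ)
    {y : (Fin n → ℕ) → Fin n → ℝ} (hy : IsGridAlloc y) :
    gridRev ε y q ≤ gridRev ε (optAlloc ε q) q :=
  (exists_gridRev_max ε q).choose_spec.2 y hy

/-- The profiles of grid levels of a sample. -/
noncomputable def sampleLevels (ε h : ℝ≥0) (s : Fin m → Fin n → ℝ≥0) :
    Fin m → Fin n → Fin (level ε h + 1) :=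
  fun j i => capLevel ε (level ε h) (s j i)

/-- The mechanism learned from the sample `s`: a revenue maximal grid mechanism for the product of
the empirical laws of the levels. -/
noncomputable def learner (ε h : ℝ≥0) (s : Fin m → Fin n → ℝ≥0) : Mechanism n :=
  gridMech ε (optAlloc ε (freq (sampleLevels ε h s))) (optAlloc_isGridAlloc _ _)

variable {ε h : ℝ≥0}

lemma measurable_sampleLevels :
    Measurable (sampleLevels ε h : (Fin m → Fin n → ℝ≥0) → _) :=
  measurable_pi_lambda _ fun j => measurable_pi_lambda _ fun i =>
    (measurable_capLevel _ _).comp ((measurable_pi_apply i).comp (measurable_pi_apply j))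

lemma learner_isOptimal (hm : 0 < m) (hε : 0 < ε) {s : Fin m → Fin n → ℝ≥0}
    (hs : ∀ j i, s j i ≤ h) :
    (learner ε h s).IsOptimal (empiricalProduct fun j i => roundDown ε (s j i)) := by
  have : ∀ i, IsProbabilityMeasure (empirical (fun j i => roundDown ε (s j i)) i) :=
    isProbabilityMeasure_empirical hm _
  have hround : ∀ j i, roundDown ε (s j i) ≤ h := fun j i => by
    refine le_trans ?_ (hs j i)
    rw [← NNReal.coe_le_coe, roundDown_eq]
    exact_mod_cast level_mul_le hε (s j i)
  have hle : ∀ i, ∀ᵐ v ∂(empirical (fun j i => roundDown ε (s j i)) i), v ≤ h :=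
    fun i => ae_empirical fun j => hround j i
  have hE : levelProb ε h (empirical fun j i => roundDown ε (s j i))
      = freq (sampleLevels ε h s) := by
    rw [levelProb_empirical]
    simp only [capLevel_roundDown hε]
    rfl
  refine ⟨gridMech_isAdmissible hε _ hle, fun M hM => ?_⟩
  -- Rounded samples are their own grid points, so nothing is lost by passing to the grid.
  obtain ⟨x, hx, hMx⟩ := exists_gridRev_ge (c := 0) hε le_rfl zero_le_one (fun i =>
    ae_empirical fun j => ⟨hround j i, by
      rw [level_roundDown hε, roundDown_eq]; push_cast; simp⟩) M hM
  have hrev : (learner ε h s).rev (empiricalProduct fun j i => roundDown ε (s j i))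
      = gridRev ε (optAlloc ε (freq (sampleLevels ε h s))) (freq (sampleLevels ε h s)) :=
    (rev_gridMech (optAlloc_isGridAlloc _ _) hle).trans (congrArg (gridRev ε _) hE)
  rw [zero_mul, add_zero] at hMx
  rw [hrev]
  refine le_trans ?_ (gridRev_le_optAlloc _ hx)
  rw [← hE]
  exact hMx

variable {D : Fin n → Measure ℝ≥0} [∀ i, IsProbabilityMeasure (D i)]

lemma rev_learner (hD : ∀ i, ∀ᵐ v ∂(D i), v ≤ h) (s : Fin m → Fin n → ℝ≥0) :
    (learner ε h s).rev (Measure.pi D)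
      = gridRev ε (optAlloc ε (freq (sampleLevels ε h s))) (levelProb ε h D) :=
  rev_gridMech _ hD

lemma measurable_rev_learner (hD : ∀ i, ∀ᵐ v ∂(D i), v ≤ h) :
    Measurable fun s : Fin m → Fin n → ℝ≥0 => (learner ε h s).rev (Measure.pi D) := by
  simp only [rev_learner hD]
  exact (measurable_of_countable fun t : Fin m → Fin n → Fin (level ε h + 1) =>
    gridRev ε (optAlloc ε (freq t)) (levelProb ε h D)).comp measurable_sampleLevels

lemma integrable_rev_learner (hε : 0 < ε) (hD : ∀ i, ∀ᵐ v ∂(D i), v ≤ h) :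
    Integrable (fun s : Fin m → Fin n → ℝ≥0 => (learner ε h s).rev (Measure.pi D))
      (sampleLaw m D) := by
  have : IsProbabilityMeasure (sampleLaw m D) := by unfold sampleLaw; infer_instance
  refine Integrable.of_bound (measurable_rev_learner hD).aestronglyMeasurable h
    (Filter.Eventually.of_forall fun s => ?_)
  have h0 : 0 ≤ (learner ε h s).rev (Measure.pi D) := rev_gridMech_nonneg _ _
  rw [Real.norm_of_nonneg h0]
  exact rev_le_of_isAdmissible hD _ (gridMech_isAdmissible hε _ hD)

/-- Optimality on the empirical law transfers to the true law at the cost of rounding and of twice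
the total variation distance of the two laws of the levels. -/
lemma optRev_le_rev_learner (hε : 0 < ε) (hD : ∀ i, ∀ᵐ v ∂(D i), v ≤ h)
    (s : Fin m → Fin n → ℝ≥0) {δ : ℝ}
    (hδ : ∑ k : Fin n → Fin (level ε h + 1),
      |∏ i, freq (sampleLevels ε h s) i (k i) - ∏ i, levelProb ε h D i (k i)| ≤ δ) :
    optRev (Measure.pi D) ≤ (learner ε h s).rev (Measure.pi D) + ε + 2 * (h * δ) := by
  refine optRev_le (gridMech_isAdmissible hε (isGridAlloc_zero n) hD) fun M hM => ?_
  obtain ⟨x, hx, hMx⟩ := exists_gridRev_ge (c := 1) hε zero_le_one le_rfl (fun i => by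
    filter_upwards [hD i] with v hv using ⟨hv, le_level_add_one_mul hε v⟩) M hM
  have h1 := gridRev_le_add hε hx (levelProb ε h D) (freq (sampleLevels ε h s))
  have h2 := gridRev_le_optAlloc (ε := ε) (freq (sampleLevels ε h s)) hx
  have h3 := gridRev_le_add hε (optAlloc_isGridAlloc ε (freq (sampleLevels ε h s)))
    (freq (sampleLevels ε h s)) (levelProb ε h D)
  have h4 : (h : ℝ) * ∑ k : Fin n → Fin (level ε h + 1),
      |∏ i, freq (sampleLevels ε h s) i (k i) - ∏ i, levelProb ε h D i (k i)| ≤ h * δ :=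
    mul_le_mul_of_nonneg_left hδ h.coe_nonneg
  simp only [abs_sub_comm (∏ i, levelProb ε h D i _)] at h1
  rw [rev_learner hD]
  linarith

/-- The law of the levels of a sample is a product law. -/
lemma sampleLaw_real_fiber (t : Fin m → Fin n → Fin (level ε h + 1)) :
    (sampleLaw m D).real (sampleLevels ε h ⁻¹' {t}) = ∏ j, ∏ i, levelProb ε h D i (t j i) := by
  have := real_pi_fiber (D := fun _ : Fin m => Measure.pi D)
    (idx := fun v i => capLevel ε (level ε h) (v i)) t
  simp only [real_pi_fiber] at this
  exact this

/-- The loss of `13 ε` is `ε` for rounding and `2 * h * (6 * ε / h)` for the total variation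
distance. -/
theorem learner_rev_ge_with_high_probability (hm : 0 < m) (hε : 0 < ε)
    (hD : ∀ i, ∀ᵐ v ∂(D i), v ≤ h) {γ : ℝ} (hγ0 : 0 < γ) (hγ1 : γ < 1)
    (hsize : ((h : ℝ) / ε) ^ 2 * (n * ((h : ℝ) / ε) * Real.log (2 + n * ((h : ℝ) / ε))
      + Real.log (1 / γ)) ≤ m) :
    1 - γ ≤ (sampleLaw m D).real {s | optRev (Measure.pi D) - 13 * ε
      ≤ (learner ε h s).rev (Measure.pi D)} := by
  have hP : IsProbabilityMeasure (sampleLaw m D) := by unfold sampleLaw; infer_instance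
  have hε' : (0 : ℝ) < ε := hε
  set a : ℝ := (h : ℝ) / ε with ha
  have hha : (h : ℝ) = a * ε := by rw [ha]; field_simp
  rcases lt_or_ge a 1 with ha1 | ha1
  · -- Here `h < ε`, and the nonnegative revenue of the learner is good enough.
    have hopt : optRev (Measure.pi D) ≤ h :=
      optRev_le (gridMech_isAdmissible hε (isGridAlloc_zero n) hD)
        (rev_le_of_isAdmissible hD)
    have huniv : {s : Fin m → Fin n → ℝ≥0 | optRev (Measure.pi D) - 13 * ε
        ≤ (learner ε h s).rev (Measure.pi D)} = Set.univ := by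
      refine Set.eq_univ_of_forall fun s => ?_
      have h1 : 0 ≤ (learner ε h s).rev (Measure.pi D) := rev_gridMech_nonneg _ _
      show optRev (Measure.pi D) - 13 * ε ≤ (learner ε h s).rev (Measure.pi D)
      nlinarith
    rw [huniv, probReal_univ]
    linarith
  have hKa : (level ε h : ℝ) ≤ a := by
    rw [ha, le_div_iff₀ hε']; exact level_mul_le hε h
  set Θ : ℝ := ((m : ℝ) + 1) ^ (n * (level ε h + 1)) / γ with hΘdef
  have hΘ : 0 < Θ := by positivity
  have hδ : 2 * √(Real.log Θ / m) ≤ 6 / a := by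
    have h1 := log_types_div_le (n := n) hm ha1 hKa hγ0 hγ1 hsize
    have h2 : √(Real.log Θ / m) ≤ √((3 / a) ^ 2) := by
      refine Real.sqrt_le_sqrt (h1.trans_eq ?_)
      rw [div_pow 3 a]; norm_num
    rw [Real.sqrt_sq (by positivity)] at h2
    calc _ ≤ 2 * (3 / a) := by linarith
      _ = 6 / a := by ring
  set bad : Finset (Fin m → Fin n → Fin (level ε h + 1)) :=
    Finset.univ.filter fun t => Θ * ∏ j, ∏ i, levelProb ε h D i (t j i)
      ≤ ∏ j, ∏ i, freq t i (t j i) with hbad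
  have hbadP : (sampleLaw m D).real (sampleLevels ε h ⁻¹' (bad : Set _)) ≤ γ := by
    rw [← sum_measureReal_preimage_singleton bad
      fun t _ => measurable_sampleLevels (measurableSet_singleton t)]
    simp only [sampleLaw_real_fiber]
    refine (sum_bad_le hm hΘ (levelProb ε h D)).trans_eq ?_
    rw [hΘdef, Fintype.card_fin]
    have : ((m : ℝ) + 1) ^ (n * (level ε h + 1)) ≠ 0 := by positivity
    field_simp
  have hsub : (sampleLevels ε h ⁻¹' (bad : Set _))ᶜ ⊆ {s : Fin m → Fin n → ℝ≥0 |
      optRev (Measure.pi D) - 13 * ε ≤ (learner ε h s).rev (Measure.pi D)} := by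
    intro s hs
    have hs' : ∏ j, ∏ i, freq (sampleLevels ε h s) i (sampleLevels ε h s j i)
        < Θ * ∏ j, ∏ i, levelProb ε h D i (sampleLevels ε h s j i) := by
      simpa [hbad] using hs
    have htv := sum_abs_prod_sub_le hm hΘ levelProb_nonneg sum_levelProb _ hs'
    have := optRev_le_rev_learner hε hD s (htv.trans hδ)
    have h6 : (h : ℝ) * (6 / a) = 6 * ε := by
      rw [hha]; field_simp
    show optRev (Measure.pi D) - 13 * ε ≤ (learner ε h s).rev (Measure.pi D)
    linarith
  have hcompl := probReal_compl_eq_one_sub (μ := sampleLaw m D)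
    (s := sampleLevels ε h ⁻¹' (bad : Set _))
    (measurable_sampleLevels bad.measurableSet)
  calc 1 - γ ≤ (sampleLaw m D).real (sampleLevels ε h ⁻¹' (bad : Set _))ᶜ := by
        rw [hcompl]; linarith
    _ ≤ _ := measureReal_mono hsub

/-- The bound in expectation follows from the one with high probability at failure probability
`1 / (2 + n h / ε)`, since failures cost at most `h`. -/
theorem learner_rev_ge_in_expectation (hm : 0 < m) (hε : 0 < ε)
    (hD : ∀ i, ∀ᵐ v ∂(D i), v ≤ h)
    (hsize : 2 * (n * ((h : ℝ) / ε) ^ 3 * Real.log (2 + n * ((h : ℝ) / ε))) ≤ m) :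
    optRev (Measure.pi D) - 14 * ε
      ≤ ∫ s, (learner ε h s).rev (Measure.pi D) ∂(sampleLaw m D) := by
  have hP : IsProbabilityMeasure (sampleLaw m D) := by unfold sampleLaw; infer_instance
  have hε' : (0 : ℝ) < ε := hε
  have hzero := gridMech_isAdmissible hε (isGridAlloc_zero n) hD
  have hrev0 : ∀ s : Fin m → Fin n → ℝ≥0, 0 ≤ (learner ε h s).rev (Measure.pi D) :=
    fun s => rev_gridMech_nonneg _ _
  have hint0 : 0 ≤ ∫ s : Fin m → Fin n → ℝ≥0, (learner ε h s).rev (Measure.pi D)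
      ∂(sampleLaw m D) := integral_nonneg hrev0
  rcases Nat.eq_zero_or_pos n with rfl | hn
  · have : optRev (Measure.pi D) ≤ 0 :=
      optRev_le hzero fun M _ => by simp [Mechanism.rev]
    linarith
  have hopt : optRev (Measure.pi D) ≤ h := optRev_le hzero (rev_le_of_isAdmissible hD)
  set a : ℝ := (h : ℝ) / ε with ha
  have hha : (h : ℝ) = a * ε := by rw [ha]; field_simp
  rcases lt_or_ge a 1 with ha1 | ha1
  · nlinarith
  have hn' : (1 : ℝ) ≤ n := by exact_mod_cast hn
  have hN1 : 1 ≤ n * a := by nlinarith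
  have haN : a ≤ n * a := by nlinarith
  set γ : ℝ := 1 / (2 + n * a) with hγ
  have hγ0 : 0 < γ := by positivity
  have hγ1 : γ < 1 := by rw [hγ, div_lt_one (by positivity)]; linarith
  have hL : 0 ≤ Real.log (2 + n * a) := Real.log_nonneg (by linarith)
  have hprob := learner_rev_ge_with_high_probability (m := m) (h := h) (D := D) hm hε hD hγ0 hγ1 (by
    rw [← ha, hγ, one_div_one_div]
    calc a ^ 2 * (n * a * Real.log (2 + n * a) + Real.log (2 + n * a))
        ≤ a ^ 2 * (n * a * Real.log (2 + n * a) + n * a * Real.log (2 + n * a)) := by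
          gcongr
          nlinarith
      _ = 2 * (n * a ^ 3 * Real.log (2 + n * a)) := by ring
      _ ≤ m := hsize)
  set S := {s : Fin m → Fin n → ℝ≥0 | optRev (Measure.pi D) - 13 * ε
      ≤ (learner ε h s).rev (Measure.pi D)} with hS
  have hSm : MeasurableSet S := measurableSet_le measurable_const (measurable_rev_learner hD)
  rcases le_total (optRev (Measure.pi D) - 13 * ε) 0 with hneg | hpos
  · linarith
  have hlow : (sampleLaw m D).real S * (optRev (Measure.pi D) - 13 * ε)
      ≤ ∫ s, (learner ε h s).rev (Measure.pi D) ∂(sampleLaw m D) := by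
    rw [← smul_eq_mul, ← integral_indicator_const _ hSm]
    refine integral_mono ((integrable_const _).indicator hSm) (integrable_rev_learner hε hD)
      fun s => ?_
    by_cases hs : s ∈ S
    · simp only [Set.indicator_of_mem hs]
      exact hs
    · simp only [Set.indicator_of_notMem hs]
      exact hrev0 s
  have hγh : γ * h ≤ ε := by
    rw [hha, hγ, div_mul_eq_mul_div, one_mul, div_le_iff₀ (by positivity)]
    nlinarith
  nlinarith [mul_le_mul_of_nonneg_right hprob hpos]

end Learner

theorem mainTheorem6 :
    ∃ C : ℝ, 0 < C ∧
      ∀ (n : ℕ) (h ε : ℝ≥0) (m : ℕ), 0 < h → 0 < ε → 0 < m →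
        ∃ A : (Fin m → Fin n → ℝ≥0) → Mechanism n,
          -- every learned mechanism is DSIC and IR
          (∀ s, (A s).IsDSIC ∧ (A s).IsIR) ∧
          -- samples and reports enter only through their values rounded down to multiples of ε
          (∀ s, A s = A fun j i => roundDown ε (s j i)) ∧
          (∀ s v, (A s).alloc v = (A s).alloc (fun i => roundDown ε (v i)) ∧
            (A s).pay v = (A s).pay (fun i => roundDown ε (v i))) ∧
          -- the learned mechanism is an optimal auction for the empirical product distribution
          -- of the rounded samples
          (∀ s, (∀ j i, s j i ≤ h) →
            (A s).IsOptimal (empiricalProduct fun j i => roundDown ε (s j i))) ∧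
          ∀ D : Fin n → Measure ℝ≥0, (∀ i, IsProbabilityMeasure (D i)) →
            (∀ i, ∀ᵐ v ∂(D i), v ≤ h) →
            -- the revenues in question are well defined
            (∀ s, (∀ j i, s j i ≤ h) → (A s).IsAdmissible (Measure.pi D)) ∧
            Integrable (fun s => (A s).rev (Measure.pi D)) (sampleLaw m D) ∧
            -- guarantee in expectation over the samples
            (C * (n * ((h : ℝ) / ε) ^ 3 * Real.log (2 + n * ((h : ℝ) / ε))) ≤ m →
              optRev (Measure.pi D) - C * ε ≤
                ∫ s, (A s).rev (Measure.pi D) ∂(sampleLaw m D)) ∧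
            -- guarantee with probability at least 1 - γ over the samples
            (∀ γ : ℝ, 0 < γ → γ < 1 →
              C * (((h : ℝ) / ε) ^ 2 * (n * ((h : ℝ) / ε) * Real.log (2 + n * ((h : ℝ) / ε))
                + Real.log (1 / γ))) ≤ m →
              1 - γ ≤ (sampleLaw m D).real
                {s | optRev (Measure.pi D) - C * ε ≤ (A s).rev (Measure.pi D)}) := by
  refine ⟨14, by norm_num, fun n h ε m _ hε hm => ⟨learner ε h,
    fun s => ⟨gridMech_isDSIC hε _, gridMech_isIR hε _⟩, fun s => ?_, fun s v => ?_,
    fun s hs => learner_isOptimal hm hε hs, fun D hD1 hD =>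
    ⟨fun s _ => gridMech_isAdmissible hε _ hD, integrable_rev_learner hε hD, fun hsize => ?_,
      fun γ hγ0 hγ1 hsize => ?_⟩⟩⟩
  · have : sampleLevels ε h (fun j i => roundDown ε (s j i)) = sampleLevels ε h s :=
      funext fun j => funext fun i => capLevel_roundDown hε _ (s j i)
    simp only [learner, this]
  · simp only [learner, gridMech, level_roundDown hε, and_self]
  · have hL : 0 ≤ Real.log (2 + n * ((h : ℝ) / ε)) :=
      Real.log_nonneg (by linarith [show 0 ≤ n * ((h : ℝ) / ε) by positivity])
    have hX : 0 ≤ n * ((h : ℝ) / ε) ^ 3 * Real.log (2 + n * ((h : ℝ) / ε)) := by positivity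
    exact learner_rev_ge_in_expectation hm hε hD (by linarith)
  · have hL : 0 ≤ Real.log (2 + n * ((h : ℝ) / ε)) :=
      Real.log_nonneg (by linarith [show 0 ≤ n * ((h : ℝ) / ε) by positivity])
    have hG : 0 ≤ Real.log (1 / γ) := Real.log_nonneg (by rw [one_le_div hγ0]; exact hγ1.le)
    have hX : 0 ≤ ((h : ℝ) / ε) ^ 2 * (n * ((h : ℝ) / ε) * Real.log (2 + n * ((h : ℝ) / ε))
        + Real.log (1 / γ)) := by positivity
    have hP : IsProbabilityMeasure (sampleLaw m D) := by unfold sampleLaw; infer_instance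
    refine (learner_rev_ge_with_high_probability hm hε hD hγ0 hγ1 (by linarith)).trans
      (measureReal_mono fun s hs => ?_)
    have hs' : optRev (Measure.pi D) - 13 * ε ≤ (learner ε h s).rev (Measure.pi D) := hs
    show optRev (Measure.pi D) - 14 * ε ≤ (learner ε h s).rev (Measure.pi D)
    linarith [ε.coe_nonneg]
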